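/- **Setting.** $L_{HA}$ is the language of Heyting arithmetic ($=,0,1,+,\cdot$ and $\lor,\land,\to,\exists,\forall$), and $X$ is a fresh unary predicate symbol. The class ${\cal H}$ of (Rasiowa-)Harrop formulas of $L_{HA}$ is the least class that contains all equations and, with $H,G$, also $H\land G$, $\forall x H$, and $A\to H$ for any formula $A$ of $L_{HA}$. The class ${\cal HM}$ of formulas of $L_{HA}\cup\{X\}$ is the least class that contains all equations and atoms $X(t)$, is closed under $\lor,\land,\exists,\forall$, and contains $L\to R$ whenever $L\in{\cal H}$ and $R\in{\cal HM}$. For each $\Phi(X,x)\in{\cal HM}$ with no free variable but $x$ add to $L_{HA}$ a unary set constant $I^{\Phi}$; sentences below are sentences of this expanded language, closed terms being identified with their values. ${\cal HM}(I)$ is the class of sentences obtained from ${\cal HM}$-sentences by substituting some $I^{\Phi}$ for $X$ (it includes the ${\cal HM}$-sentences without $X$). Let $\bot$ stand for any false and $\top$ for any true equation between closed terms. The infinitary calculus derives sequents $\Gamma\Rightarrow C$, where $\Gamma$ is a finite set of sentences and $C$ a sentence. Its initial sequents are $\Gamma,I^{\Phi}(t)\Rightarrow I^{\Phi}(t)$;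 $\Gamma,\bot\Rightarrow C$; $\Gamma\Rightarrow\top$. Its inference rules are the intuitionistic left and right rules for $\lor,\land,\to,\exists,\forall$, with the $\omega$-rule (one premiss for each numeral $\bar n$) for $\exists$ on the left and $\forall$ on the right; the rules inferring $\Gamma,I^{\Phi}(t)\Rightarrow C$ from $\Gamma,\Phi(I^{\Phi},t)\Rightarrow C$ and $\Gamma\Rightarrow I^{\Phi}(t)$ from $\Gamma\Rightarrow\Phi(I^{\Phi},t)$; the repetition rule; and the cut rule, inferring $\Gamma,\Delta\Rightarrow C$ from $\Gamma\Rightarrow A$ and $\Delta,A\Rightarrow C$. The rank of a sentence is $0$ if it is in ${\cal H}$, $1$ if it is in ${\cal HM}(I)\setminus{\cal H}$, and $2$ otherwise. The rank of a derivation is the maximum of the ranks of its cut formulas ($0$ if there is no cut), and its depth is the depth of the well-founded tree. Fix a bound $N\in\mathbb N\cup\{\infty\}$, and let $\vdash^{\alpha}_{r}\Gamma\Rightarrow C$ mean that $\Gamma\Rightarrow C$ has a derivation of depth at most $\alpha$ and of rank less than $r$ in which every sentence has fewer than $N$ occurrences of logical connectives and quantifiers. **Theorem.** Let $\Gamma_0$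 be a finite set of ${\cal H}$-sentences, $C_0\in{\cal HM}(I)$, and $\alpha$ an ordinal. If $\vdash^{\alpha}_{2}\Gamma_0\Rightarrow C_0$, then $\vdash^{\omega^{\alpha}+1}_{1}\Gamma_0\Rightarrow C_0$. That is, a derivation of depth at most $\alpha$ with cuts of rank at most $1$ only can be replaced by a derivation of depth at most $\omega^{\alpha}+1$ with cuts of rank $0$ only, with the same bound $N$ on logical complexities. -/

import Mathlib

namespace FixedPointHM

/-! ### The language -/

/-- Terms of the language of Heyting arithmetic with free variables among `k` variables
(de Bruijn indices). -/
inductive Term : ℕ → Type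
  | var {k : ℕ} (i : Fin k) : Term k
  | zero {k : ℕ} : Term k
  | one {k : ℕ} : Term k
  | add {k : ℕ} (s t : Term k) : Term k
  | mul {k : ℕ} (s t : Term k) : Term k

/-- Simultaneous substitution of terms for variables. -/
def Term.subst {k m : ℕ} (σ : Fin k → Term m) : Term k → Term m
  | .var i => σ i
  | .zero => .zero
  | .one => .one
  | .add s t => .add (s.subst σ) (t.subst σ)
  | .mul s t => .mul (s.subst σ) (t.subst σ)

/-- The value of a term under an assignment. -/
def Term.eval {k : ℕ} (v : Fin k → ℕ) : Term k → ℕ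
  | .var i => v i
  | .zero => 0
  | .one => 1
  | .add s t => s.eval v + t.eval v
  | .mul s t => s.eval v * t.eval v

/-- The value of a closed term. -/
def Term.val (t : Term 0) : ℕ := t.eval Fin.elim0

/-- The `n`th numeral. -/
def Term.numeral {k : ℕ} : ℕ → Term k
  | 0 => .zero
  | n + 1 => .add (Term.numeral n) .one

/-- Formulas with free variables among `k` variables, built from equations and atoms `p(t)` for
unary predicate symbols `p : P` by the intuitionistic connectives and quantifiers. In `ex A` and
`all A` the bound variable is the variable `0` of `A`. The language of Heyting arithmetic extended
by one predicate symbol `X` is the case `P = Unit`. -/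
inductive Formula (P : Type) : ℕ → Type
  | eq {k : ℕ} (s t : Term k) : Formula P k
  | pred {k : ℕ} (p : P) (t : Term k) : Formula P k
  | or {k : ℕ} (A B : Formula P k) : Formula P k
  | and {k : ℕ} (A B : Formula P k) : Formula P k
  | imp {k : ℕ} (A B : Formula P k) : Formula P k
  | ex {k : ℕ} (A : Formula P (k + 1)) : Formula P k
  | all {k : ℕ} (A : Formula P (k + 1)) : Formula P k

/-- Going under a quantifier: the new variable `0` is fixed, the other variables are substituted
as before. -/
def liftSubst {k m : ℕ} (σ : Fin k → Term m) : Fin (k + 1) → Term (m + 1) :=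
  Fin.cases (.var 0) (fun i => (σ i).subst (fun j => .var j.succ))

/-- Simultaneous (capture avoiding) substitution of terms for the free variables. -/
def Formula.subst {P : Type} : {k m : ℕ} → (Fin k → Term m) → Formula P k → Formula P m
  | _, _, σ, .eq s t => .eq (s.subst σ) (t.subst σ)
  | _, _, σ, .pred p t => .pred p (t.subst σ)
  | _, _, σ, .or A B => .or (A.subst σ) (B.subst σ)
  | _, _, σ, .and A B => .and (A.subst σ) (B.subst σ)
  | _, _, σ, .imp A B => .imp (A.subst σ) (B.subst σ)
  | _, _, σ, .ex A => .ex (A.subst (liftSubst σ))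
  | _, _, σ, .all A => .all (A.subst (liftSubst σ))

/-- `A(t)`, for a formula `A(x)` with at most one free variable and a closed term `t`. -/
def Formula.inst {P : Type} (A : Formula P 1) (t : Term 0) : Formula P 0 :=
  A.subst (fun _ => t)

/-- Substitution of predicate symbols for predicate symbols. -/
def Formula.mapPred {P Q : Type} (f : P → Q) : {k : ℕ} → Formula P k → Formula Q k
  | _, .eq s t => .eq s t
  | _, .pred p t => .pred (f p) t
  | _, .or A B => .or (A.mapPred f) (B.mapPred f)
  | _, .and A B => .and (A.mapPred f) (B.mapPred f)
  | _, .imp A B => .imp (A.mapPred f) (B.mapPred f)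
  | _, .ex A => .ex (A.mapPred f)
  | _, .all A => .all (A.mapPred f)

/-- Logical complexity: the number of occurrences of connectives and quantifiers. -/
def Formula.complexity {P : Type} : {k : ℕ} → Formula P k → ℕ
  | _, .eq _ _ => 0
  | _, .pred _ _ => 0
  | _, .or A B => A.complexity + B.complexity + 1
  | _, .and A B => A.complexity + B.complexity + 1
  | _, .imp A B => A.complexity + B.complexity + 1
  | _, .ex A => A.complexity + 1
  | _, .all A => A.complexity + 1

/-- The formula is a formula of Heyting arithmetic: no predicate symbol occurs in it. -/
def Formula.PredFree {P : Type} : {k : ℕ} → Formula P k → Prop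
  | _, .eq _ _ => True
  | _, .pred _ _ => False
  | _, .or A B => A.PredFree ∧ B.PredFree
  | _, .and A B => A.PredFree ∧ B.PredFree
  | _, .imp A B => A.PredFree ∧ B.PredFree
  | _, .ex A => A.PredFree
  | _, .all A => A.PredFree

/-- The class `𝓗` of (Rasiowa-)Harrop formulas. They are arithmetical formulas: no predicate symbol
occurs in them. -/
def Formula.IsHarrop {P : Type} : {k : ℕ} → Formula P k → Prop
  | _, .eq _ _ => True
  | _, .pred _ _ => False
  | _, .or _ _ => False
  | _, .and A B => A.IsHarrop ∧ B.IsHarrop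
  | _, .imp A B => A.PredFree ∧ B.IsHarrop
  | _, .ex _ => False
  | _, .all A => A.IsHarrop

/-- The class `𝓗𝓜`. -/
def Formula.IsHM {P : Type} : {k : ℕ} → Formula P k → Prop
  | _, .eq _ _ => True
  | _, .pred _ _ => True
  | _, .or A B => A.IsHM ∧ B.IsHM
  | _, .and A B => A.IsHM ∧ B.IsHM
  | _, .imp A B => A.IsHarrop ∧ B.IsHM
  | _, .ex A => A.IsHM
  | _, .all A => A.IsHM

/-- Operators `Φ(X, x)` in `𝓗𝓜`, with no free variable but `x`. -/
def Operator : Type := {Φ : Formula Unit 1 // Φ.IsHM}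

/-- Closed formulas of the language of Heyting arithmetic extended by a set constant `I^Φ` for each
operator `Φ`; the atom `I^Φ(t)` is `Formula.pred Φ t`. -/
abbrev ClosedFormula : Type := Formula Operator 0

/-- `Φ(I^Φ, t)`. -/
def Operator.unfold (Φ : Operator) (t : Term 0) : ClosedFormula :=
  (Φ.1.mapPred (fun _ => Φ)).inst t

/-! ### Sentences: closed terms are identified with their values -/

/-- `B` arises from `A` by replacing a closed term by the numeral of its value. -/
def ReplaceByValue (A B : ClosedFormula) : Prop :=
  ∃ (F : Formula Operator 1) (t : Term 0), A = F.inst t ∧ B = F.inst (Term.numeral t.val)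

/-- Sentences: closed formulas, where each closed term is identified with its value (the quotient
by the equivalence relation that `ReplaceByValue` generates). -/
def Sentence : Type := Quot ReplaceByValue

/-- The sentence given by a closed formula. -/
def Sentence.mk (A : ClosedFormula) : Sentence := Quot.mk _ A

noncomputable instance : DecidableEq Sentence := Classical.decEq _

theorem Formula.complexity_subst {P : Type} {k : ℕ} (A : Formula P k) :
    ∀ {m : ℕ} (σ : Fin k → Term m), (A.subst σ).complexity = A.complexity := by
  induction A <;> intro m σ <;> simp_all [Formula.subst, Formula.complexity]

/-- Logical complexity of a sentence. -/
def Sentence.complexity : Sentence → ℕ :=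
  Quot.lift Formula.complexity (by
    rintro _ _ ⟨F, t, rfl, rfl⟩
    simp [Formula.inst, Formula.complexity_subst])

/-- `𝓗`-sentences. -/
def Sentence.IsHarrop (S : Sentence) : Prop :=
  ∃ A : ClosedFormula, A.IsHarrop ∧ S = Sentence.mk A

/-- The class `𝓗𝓜(I)`: sentences obtained from `𝓗𝓜`-sentences by substituting some `I^Φ` for `X`.
Those `𝓗𝓜`-sentences in which `X` does not occur are included. -/
def Sentence.IsHMI (S : Sentence) : Prop :=
  ∃ (R : Formula Unit 0) (Φ : Operator), R.IsHM ∧ S = Sentence.mk (R.mapPred (fun _ => Φ))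

open Classical in
/-- The rank of a sentence. -/
noncomputable def Sentence.rk (S : Sentence) : ℕ :=
  if S.IsHarrop then 0 else if S.IsHMI then 1 else 2

/-! ### The infinitary calculus -/

/-- Sequents `Γ ⇒ C`. -/
structure Sequent where
  ant : Finset Sentence
  suc : Sentence

infix:45 " ⟹ " => Sequent.mk

/-- `Inference prem S`: the sequent `S` follows from the family `prem` of upper sequents by one
inference rule other than cut. Initial sequents are rules without upper sequents; `⊥` and `⊤` stand
for false and true equations between closed terms. Antecedents are sets, so `Γ, A` is
`insert A Γ`. -/
inductive Inference : {ι : Type} → (ι → Sequent) → Sequent → Prop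
  | initI (Γ : Finset Sentence) (Φ : Operator) (t : Term 0) :
      Inference ![] (insert (.mk (.pred Φ t)) Γ ⟹ .mk (.pred Φ t))
  | initBot (Γ : Finset Sentence) (s t : Term 0) (h : s.val ≠ t.val) (C : Sentence) :
      Inference ![] (insert (.mk (.eq s t)) Γ ⟹ C)
  | initTop (Γ : Finset Sentence) (s t : Term 0) (h : s.val = t.val) :
      Inference ![] (Γ ⟹ .mk (.eq s t))
  | leftI (Γ : Finset Sentence) (Φ : Operator) (t : Term 0) (C : Sentence) :
      Inference ![insert (.mk (Φ.unfold t)) Γ ⟹ C]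
        (insert (.mk (.pred Φ t)) Γ ⟹ C)
  | rightI (Γ : Finset Sentence) (Φ : Operator) (t : Term 0) :
      Inference ![Γ ⟹ .mk (Φ.unfold t)] (Γ ⟹ .mk (.pred Φ t))
  | leftOr (Γ : Finset Sentence) (A B : ClosedFormula) (C : Sentence) :
      Inference ![insert (.mk A) Γ ⟹ C, insert (.mk B) Γ ⟹ C]
        (insert (.mk (.or A B)) Γ ⟹ C)
  | rightOr₀ (Γ : Finset Sentence) (A B : ClosedFormula) :
      Inference ![Γ ⟹ .mk A] (Γ ⟹ .mk (.or A B))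
  | rightOr₁ (Γ : Finset Sentence) (A B : ClosedFormula) :
      Inference ![Γ ⟹ .mk B] (Γ ⟹ .mk (.or A B))
  | leftAnd₀ (Γ : Finset Sentence) (A B : ClosedFormula) (C : Sentence) :
      Inference ![insert (.mk A) (insert (.mk (.and A B)) Γ) ⟹ C]
        (insert (.mk (.and A B)) Γ ⟹ C)
  | leftAnd₁ (Γ : Finset Sentence) (A B : ClosedFormula) (C : Sentence) :
      Inference ![insert (.mk B) (insert (.mk (.and A B)) Γ) ⟹ C]
        (insert (.mk (.and A B)) Γ ⟹ C)
  | rightAnd (Γ : Finset Sentence) (A B : ClosedFormula) :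
      Inference ![Γ ⟹ .mk A, Γ ⟹ .mk B] (Γ ⟹ .mk (.and A B))
  | leftImp (Γ : Finset Sentence) (A B : ClosedFormula) (C : Sentence) :
      Inference ![insert (.mk (.imp A B)) Γ ⟹ .mk A, insert (.mk B) Γ ⟹ C]
        (insert (.mk (.imp A B)) Γ ⟹ C)
  | rightImp (Γ : Finset Sentence) (A B : ClosedFormula) :
      Inference ![insert (.mk A) Γ ⟹ .mk B] (Γ ⟹ .mk (.imp A B))
  | leftEx (Γ : Finset Sentence) (B : Formula Operator 1) (C : Sentence) :
      Inference (fun n : ℕ => insert (.mk (B.inst (Term.numeral n))) Γ ⟹ C)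
        (insert (.mk (.ex B)) Γ ⟹ C)
  | rightEx (Γ : Finset Sentence) (B : Formula Operator 1) (n : ℕ) :
      Inference ![Γ ⟹ .mk (B.inst (Term.numeral n))] (Γ ⟹ .mk (.ex B))
  | leftAll (Γ : Finset Sentence) (B : Formula Operator 1) (n : ℕ) (C : Sentence) :
      Inference ![insert (.mk (B.inst (Term.numeral n))) (insert (.mk (.all B)) Γ) ⟹ C]
        (insert (.mk (.all B)) Γ ⟹ C)
  | rightAll (Γ : Finset Sentence) (B : Formula Operator 1) :
      Inference (fun n : ℕ => Γ ⟹ .mk (B.inst (Term.numeral n))) (Γ ⟹ .mk (.all B))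
  | rep (Γ : Finset Sentence) (C : Sentence) :
      Inference ![Γ ⟹ C] (Γ ⟹ C)

/-- Infinitary derivations of a sequent: well founded trees, locally correct with respect to the
rules of the calculus, cut included. -/
inductive Derivation : Sequent → Type 1
  | rule {ι : Type} {prem : ι → Sequent} {S : Sequent} (h : Inference prem S)
      (ds : (i : ι) → Derivation (prem i)) : Derivation S
  | cut {Γ Δ : Finset Sentence} {A C : Sentence} (d : Derivation (Γ ⟹ A))
      (e : Derivation (insert A Δ ⟹ C)) : Derivation (Γ ∪ Δ ⟹ C)

/-- The depth of the well founded tree; a tree with a single node has depth `0`. -/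
noncomputable def Derivation.depth : {S : Sequent} → Derivation S → Ordinal.{0}
  | _, .rule _ ds => ⨆ i, ((ds i).depth + 1)
  | _, .cut d e => max d.depth e.depth + 1

/-- The cut formulas of a derivation. -/
def Derivation.cutFormulas : {S : Sequent} → Derivation S → Set Sentence
  | _, .rule _ ds => ⋃ i, (ds i).cutFormulas
  | _, .cut (A := A) d e => insert A (d.cutFormulas ∪ e.cutFormulas)

/-- The sequents at the nodes of a derivation. -/
def Derivation.sequents : {S : Sequent} → Derivation S → Set Sequent
  | _, .rule (S := S) _ ds => insert S (⋃ i, (ds i).sequents)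
  | _, .cut (Γ := Γ) (Δ := Δ) (C := C) d e =>
    insert (Γ ∪ Δ ⟹ C) (d.sequents ∪ e.sequents)

/-- The rank of a derivation: the maximum of the ranks of the cut formulas (these are at most `2`),
and `0` if there is no cut. -/
noncomputable def Derivation.rank {S : Sequent} (D : Derivation S) : ℕ :=
  sSup (Sentence.rk '' D.cutFormulas)

/-- All sentences that occur in the derivation have logical complexity less than `N`
(no restriction if `N = ⊤`). -/
def Derivation.ComplexityLT {S : Sequent} (D : Derivation S) (N : ℕ∞) : Prop :=
  ∀ T ∈ D.sequents, (T.suc.complexity : ℕ∞) < N ∧ ∀ A ∈ T.ant, (A.complexity : ℕ∞) < N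

/-- `⊢^α_r S`: there is a derivation of the sequent `S` of depth at most `α`, of rank less than `r`,
in which all sentences have logical complexity less than `N`. -/
def Derivable (N : ℕ∞) (α : Ordinal.{0}) (r : ℕ) (S : Sequent) : Prop :=
  ∃ D : Derivation S, D.depth ≤ α ∧ D.rank < r ∧ D.ComplexityLT N

end FixedPointHM

open FixedPointHM

namespace FixedPointHM

open Ordinal

/-! ### Evaluation and substitution -/

/-! The cuts are not permuted upwards; the derivation is read semantically and a cut-free one is
built afresh. In an HM-formula the premisses of implications are Harrop, hence arithmetical, so `X`
occurs only positively and all set constants can be interpreted by one fixed point, `leastModel`.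
`Formula.Verified` refines truth by an ordinal that bounds the depth of a cut-free proof: each
logical step and each unfolding of `I^Φ` lowers it. The premiss of an implication is only asked for
its truth value, because an arithmetical sentence is provable or refutable in finitely many steps
(`CutFree.decide_arithmetical`).

The core is `Derivation.verified`: if the antecedents are true arithmetical sentences or
HM-sentences verified with bound `β`, an HM-succedent derived in depth `δ` is verified with bound `β
+ ω^δ`. Left rules pass to antecedents with bounds below `β`, right rules use the gap between `ω^δ`
and the smaller powers, and a cut feeds the bound of its left premiss into its right one, so that
`ω^a + ω^b ≤ ω^(max a b + 1)` pays for it. Premisses outside HM can only be left premisses of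
implications or arithmetical cuts, and there soundness in `leastModel` suffices.

With true antecedents and `β = 0`, `CutFree.of_verified` turns the verification into a cut-free
derivation of depth at most `ω^δ`. A false antecedent is refuted in finite depth. -/

theorem Term.eval_subst {k m : ℕ} (σ : Fin k → Term m) (v : Fin m → ℕ) (t : Term k) :
    (t.subst σ).eval v = t.eval (fun i => (σ i).eval v) := by
  induction t <;> simp_all [Term.subst, Term.eval]

theorem Term.eval_numeral {k : ℕ} (v : Fin k → ℕ) (n : ℕ) :
    (Term.numeral n : Term k).eval v = n := by
  induction n <;> simp_all [Term.numeral, Term.eval]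

theorem Term.eval_eq_val (t : Term 0) (v : Fin 0 → ℕ) : t.eval v = t.val := by
  rw [Term.val, Subsingleton.elim v Fin.elim0]

theorem eval_liftSubst {k m : ℕ} (σ : Fin k → Term m) (v : Fin m → ℕ) (n : ℕ) :
    (fun i => (liftSubst σ i).eval (Fin.cons n v : Fin (m + 1) → ℕ)) =
      Fin.cons n (fun i => (σ i).eval v) := by
  funext i
  refine Fin.cases ?_ (fun j => ?_) i
  · simp [liftSubst, Term.eval]
  · simp [liftSubst, Term.eval_subst, Term.eval]

theorem cons_fin_zero (n : ℕ) (v : Fin 0 → ℕ) : (Fin.cons n v : Fin 1 → ℕ) = fun _ => n := by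
  funext i
  exact Fin.cases rfl (fun j => j.elim0) i

namespace Formula

/-! ### Syntactic classes -/

theorem predFree_subst {P : Type} {k : ℕ} (A : Formula P k) :
    ∀ {m : ℕ} (σ : Fin k → Term m), (A.subst σ).PredFree ↔ A.PredFree := by
  induction A <;> intro m σ <;> simp_all [Formula.subst, PredFree]

theorem isHarrop_subst {P : Type} {k : ℕ} (A : Formula P k) :
    ∀ {m : ℕ} (σ : Fin k → Term m), (A.subst σ).IsHarrop ↔ A.IsHarrop := by
  induction A <;> intro m σ <;> simp_all [Formula.subst, IsHarrop, predFree_subst]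

theorem isHM_subst {P : Type} {k : ℕ} (A : Formula P k) :
    ∀ {m : ℕ} (σ : Fin k → Term m), (A.subst σ).IsHM ↔ A.IsHM := by
  induction A <;> intro m σ <;> simp_all [Formula.subst, IsHM, isHarrop_subst]

theorem predFree_mapPred {P Q : Type} (f : P → Q) {k : ℕ} (A : Formula P k) :
    (A.mapPred f).PredFree ↔ A.PredFree := by
  induction A <;> simp_all [mapPred, PredFree]

theorem isHarrop_mapPred {P Q : Type} (f : P → Q) {k : ℕ} (A : Formula P k) :
    (A.mapPred f).IsHarrop ↔ A.IsHarrop := by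
  induction A <;> simp_all [mapPred, IsHarrop, predFree_mapPred]

theorem isHM_mapPred {P Q : Type} (f : P → Q) {k : ℕ} (A : Formula P k) :
    (A.mapPred f).IsHM ↔ A.IsHM := by
  induction A <;> simp_all [mapPred, IsHM, isHarrop_mapPred]

theorem complexity_mapPred {P Q : Type} (f : P → Q) {k : ℕ} (A : Formula P k) :
    (A.mapPred f).complexity = A.complexity := by
  induction A <;> simp_all [mapPred, complexity]

/-- The only property of Harrop formulas on which the argument rests: their truth does not depend on
the interpretation of the set constants. -/
theorem IsHarrop.predFree {P : Type} {k : ℕ} {A : Formula P k} (h : A.IsHarrop) :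
    A.PredFree := by
  induction A <;> simp_all [IsHarrop, PredFree]

/-! ### Truth in a model -/

/-- Truth, in the standard model expanded by interpretations of the predicate symbols. -/
def Sat {P : Type} (M : P → ℕ → Prop) : {k : ℕ} → Formula P k → (Fin k → ℕ) → Prop
  | _, .eq s t, v => s.eval v = t.eval v
  | _, .pred p t, v => M p (t.eval v)
  | _, .or A B, v => A.Sat M v ∨ B.Sat M v
  | _, .and A B, v => A.Sat M v ∧ B.Sat M v
  | _, .imp A B, v => A.Sat M v → B.Sat M v
  | _, .ex A, v => ∃ n : ℕ, A.Sat M (Fin.cons n v)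
  | _, .all A, v => ∀ n : ℕ, A.Sat M (Fin.cons n v)

theorem sat_subst {P : Type} (M : P → ℕ → Prop) {k : ℕ} (A : Formula P k) :
    ∀ {m : ℕ} (σ : Fin k → Term m) (v : Fin m → ℕ),
      (A.subst σ).Sat M v ↔ A.Sat M (fun i => (σ i).eval v) := by
  induction A <;> intro m σ v <;>
    simp_all [Formula.subst, Sat, Term.eval_subst, eval_liftSubst]

theorem sat_inst {P : Type} (M : P → ℕ → Prop) (B : Formula P 1) (t : Term 0)
    (v : Fin 0 → ℕ) : (B.inst t).Sat M v ↔ B.Sat M (fun _ => t.val) := by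
  simp [inst, sat_subst, Term.eval_eq_val]

theorem sat_inst_numeral {P : Type} (M : P → ℕ → Prop) (B : Formula P 1) (n : ℕ)
    (v : Fin 0 → ℕ) : (B.inst (Term.numeral n)).Sat M v ↔ B.Sat M (Fin.cons n v) := by
  rw [cons_fin_zero, inst, sat_subst]
  simp [Term.eval_numeral]

theorem sat_congr_of_predFree {P : Type} (M M' : P → ℕ → Prop) {k : ℕ} (A : Formula P k) :
    A.PredFree → ∀ v, A.Sat M v ↔ A.Sat M' v := by
  induction A <;> intro h v <;> simp_all [PredFree, Sat]

/-- Predicate symbols occur only positively: the premiss of an implication is Harrop, so its truth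
is the same in both models. -/
theorem IsHM.sat_mono {P : Type} {M M' : P → ℕ → Prop} (hM : M ≤ M') {k : ℕ}
    {A : Formula P k} (hA : A.IsHM) {v : Fin k → ℕ} (h : A.Sat M v) : A.Sat M' v := by
  induction A with
  | eq s t => exact h
  | pred p t => exact hM _ _ h
  | or A B ihA ihB => exact h.imp (ihA hA.1) (ihB hA.2)
  | and A B ihA ihB => exact h.imp (ihA hA.1) (ihB hA.2)
  | imp A B _ ihB =>
    exact fun h' => ihB hA.2 (h ((sat_congr_of_predFree M M' A hA.1.predFree v).2 h'))
  | ex A ih => exact h.imp fun _ => ih hA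
  | all A ih => exact fun n => ih hA (h n)

end Formula

/-! ### The least fixed points -/

/-- The formula `Φ(I^Φ, x)`. -/
def Operator.body (Φ : Operator) : Formula Operator 1 := Φ.1.mapPred (fun _ => Φ)

theorem Operator.isHM_body (Φ : Operator) : Φ.body.IsHM :=
  (Formula.isHM_mapPred _ _).2 Φ.2

theorem Operator.isHM_unfold (Φ : Operator) (t : Term 0) : (Φ.unfold t).IsHM :=
  (Formula.isHM_subst _ _).2 Φ.isHM_body

theorem Operator.complexity_unfold (Φ : Operator) (t : Term 0) :
    (Φ.unfold t).complexity = Φ.1.complexity :=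
  (Formula.complexity_subst _ _).trans (Formula.complexity_mapPred _ _)

/-- The monotone operator whose fixed points interpret all set constants at once. -/
def modelStep : (Operator → ℕ → Prop) →o (Operator → ℕ → Prop) where
  toFun M Φ n := Φ.body.Sat M (fun _ => n)
  monotone' _ _ h Φ _ := Φ.isHM_body.sat_mono h

/-- The set constants interpreted as least fixed points. -/
def leastModel : Operator → ℕ → Prop := modelStep.lfp

theorem leastModel_iff (Φ : Operator) (n : ℕ) :
    leastModel Φ n ↔ Φ.body.Sat leastModel (fun _ => n) :=
  iff_of_eq (congrFun (congrFun modelStep.map_lfp.symm Φ) n)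

theorem leastModel_iff_unfold (Φ : Operator) (t : Term 0) (v : Fin 0 → ℕ) :
    leastModel Φ (t.eval v) ↔ (Φ.unfold t).Sat leastModel v := by
  rw [leastModel_iff, Term.eval_eq_val]
  exact (Formula.sat_inst _ _ _ _).symm

/-! ### Truth with ordinal bounds -/

namespace Formula

/-- Truth with an ordinal bound on the depth of a verification, relative to an interpretation `J`
of the set constants that also depends on the bound. The premiss of an implication is evaluated in
the least model. -/
def Verified (J : Ordinal.{0} → Operator → ℕ → Prop) :
    {k : ℕ} → Formula Operator k → Ordinal.{0} → (Fin k → ℕ) → Prop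
  | _, .eq s t, _, v => s.eval v = t.eval v
  | _, .pred Φ t, β, v => J β Φ (t.eval v)
  | _, .or A B, β, v => ∃ γ < β, A.Verified J γ v ∨ B.Verified J γ v
  | _, .and A B, β, v => (∃ γ < β, A.Verified J γ v) ∧ ∃ γ < β, B.Verified J γ v
  | _, .imp A B, β, v => ω ≤ β ∧ (A.Sat leastModel v → ∃ γ < β, B.Verified J γ v)
  | _, .ex A, β, v => ∃ γ < β, ∃ n : ℕ, A.Verified J γ (Fin.cons n v)
  | _, .all A, β, v => ∀ n : ℕ, ∃ γ < β, A.Verified J γ (Fin.cons n v)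

theorem verified_subst (J : Ordinal.{0} → Operator → ℕ → Prop) {k : ℕ} (A : Formula Operator k) :
    ∀ {m : ℕ} (σ : Fin k → Term m) (β : Ordinal.{0}) (v : Fin m → ℕ),
      (A.subst σ).Verified J β v ↔ A.Verified J β (fun i => (σ i).eval v) := by
  induction A <;> intro m σ β v <;>
    simp_all [Formula.subst, Verified, Term.eval_subst, eval_liftSubst, sat_subst]

theorem verified_inst (J : Ordinal.{0} → Operator → ℕ → Prop) (B : Formula Operator 1)
    (t : Term 0) (β : Ordinal.{0}) (v : Fin 0 → ℕ) :
    (B.inst t).Verified J β v ↔ B.Verified J β (fun _ => t.val) := by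
  simp [inst, verified_subst, Term.eval_eq_val]

theorem verified_inst_numeral (J : Ordinal.{0} → Operator → ℕ → Prop) (B : Formula Operator 1)
    (n : ℕ) (β : Ordinal.{0}) (v : Fin 0 → ℕ) :
    (B.inst (Term.numeral n)).Verified J β v ↔ B.Verified J β (Fin.cons n v) := by
  rw [cons_fin_zero, inst, verified_subst]
  simp [Term.eval_numeral]

/-- No restriction to HM is needed, since premisses of implications are evaluated in the least model
and not in `J`. -/
theorem Verified.mono_interp {J J' : Ordinal.{0} → Operator → ℕ → Prop} (hJ : J ≤ J') {k : ℕ}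
    {A : Formula Operator k} {β : Ordinal.{0}} {v : Fin k → ℕ} (h : A.Verified J β v) :
    A.Verified J' β v := by
  induction A generalizing β with
  | eq s t => exact h
  | pred p t => exact hJ _ _ _ h
  | or A B ihA ihB => exact h.imp fun _ h => ⟨h.1, h.2.imp ihA ihB⟩
  | and A B ihA ihB =>
    exact ⟨h.1.imp fun _ h => ⟨h.1, ihA h.2⟩, h.2.imp fun _ h => ⟨h.1, ihB h.2⟩⟩
  | imp A B _ ihB => exact ⟨h.1, fun hA => (h.2 hA).imp fun _ h => ⟨h.1, ihB h.2⟩⟩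
  | ex A ih => exact h.imp fun _ h => ⟨h.1, h.2.imp fun _ => ih⟩
  | all A ih => exact fun n => (h n).imp fun _ h => ⟨h.1, ih h.2⟩

end Formula

/-- The monotone operator defining the bounded interpretation of the set constants; only operators
of logical complexity less than `N` are unfolded. -/
def stageStep (N : ℕ∞) :
    (Ordinal.{0} → Operator → ℕ → Prop) →o (Ordinal.{0} → Operator → ℕ → Prop) where
  toFun J β Φ n := (Φ.1.complexity : ℕ∞) < N ∧ ∃ γ < β, Φ.body.Verified J γ (fun _ => n)
  monotone' _ _ hJ _ _ _ h := ⟨h.1, h.2.imp fun _ h => ⟨h.1, h.2.mono_interp hJ⟩⟩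

/-- `stage N β Φ n`: the sentence `I^Φ(n)` is verified with bound `β`. -/
def stage (N : ℕ∞) : Ordinal.{0} → Operator → ℕ → Prop := (stageStep N).lfp

/-- The lattice fixed point replaces a simultaneous recursion on ordinals and formulas. Only this
equation is used later, never leastness. -/
theorem stage_iff (N : ℕ∞) (β : Ordinal.{0}) (Φ : Operator) (n : ℕ) :
    stage N β Φ n ↔
      (Φ.1.complexity : ℕ∞) < N ∧ ∃ γ < β, Φ.body.Verified (stage N) γ (fun _ => n) :=
  iff_of_eq (congrFun (congrFun (congrFun (stageStep N).map_lfp.symm β) Φ) n)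

theorem stage_iff_unfold (N : ℕ∞) (β : Ordinal.{0}) (Φ : Operator) (t : Term 0)
    (v : Fin 0 → ℕ) :
    stage N β Φ (t.eval v) ↔
      (Φ.1.complexity : ℕ∞) < N ∧ ∃ γ < β, (Φ.unfold t).Verified (stage N) γ v := by
  rw [stage_iff, Term.eval_eq_val]
  exact and_congr_right' (exists_congr fun γ => and_congr_right'
    (Formula.verified_inst _ _ _ _ _).symm)

namespace Formula

theorem Verified.mono {N : ℕ∞} {k : ℕ} {A : Formula Operator k} {β γ : Ordinal.{0}}
    {v : Fin k → ℕ} (h : A.Verified (stage N) β v) (hβ : β ≤ γ) :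
    A.Verified (stage N) γ v := by
  cases A with
  | eq s t => exact h
  | pred Φ t =>
    have h := (stage_iff _ _ _ _).1 h
    exact (stage_iff _ _ _ _).2 ⟨h.1, h.2.imp fun _ h => ⟨h.1.trans_le hβ, h.2⟩⟩
  | or A B => exact h.imp fun _ h => ⟨h.1.trans_le hβ, h.2⟩
  | and A B =>
    exact ⟨h.1.imp fun _ h => ⟨h.1.trans_le hβ, h.2⟩, h.2.imp fun _ h => ⟨h.1.trans_le hβ, h.2⟩⟩
  | imp A B => exact ⟨h.1.trans hβ, fun hA => (h.2 hA).imp fun _ h => ⟨h.1.trans_le hβ, h.2⟩⟩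
  | ex A => exact h.imp fun _ h => ⟨h.1.trans_le hβ, h.2⟩
  | all A => exact fun n => (h n).imp fun _ h => ⟨h.1.trans_le hβ, h.2⟩

/-- The induction is on the bound, which drops at every unfolding of a set constant, whereas the
formula may grow there. -/
theorem Verified.sat {N : ℕ∞} (β : Ordinal.{0}) : ∀ {k : ℕ} {A : Formula Operator k}
    {v : Fin k → ℕ}, A.Verified (stage N) β v → A.Sat leastModel v := by
  induction β using WellFoundedLT.induction with
  | ind β ih =>
    intro k A v h
    cases A with
    | eq s t => exact h
    | pred Φ t =>
      obtain ⟨-, γ, hγ, h⟩ := (stage_iff _ _ _ _).1 h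
      exact (leastModel_iff _ _).2 (ih γ hγ h)
    | or A B =>
      obtain ⟨γ, hγ, h⟩ := h
      exact h.imp (ih γ hγ) (ih γ hγ)
    | and A B =>
      obtain ⟨⟨γ, hγ, h⟩, δ, hδ, h'⟩ := h
      exact ⟨ih γ hγ h, ih δ hδ h'⟩
    | imp A B =>
      intro hA
      obtain ⟨γ, hγ, h⟩ := h.2 hA
      exact ih γ hγ h
    | ex A =>
      obtain ⟨γ, hγ, n, h⟩ := h
      exact ⟨n, ih γ hγ h⟩
    | all A =>
      intro n
      obtain ⟨γ, hγ, h⟩ := h n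
      exact ih γ hγ h

end Formula

/-! ### Sentences -/

namespace Sentence

/-- No set constant occurs in the sentence. -/
def PredFree : Sentence → Prop :=
  Quot.lift Formula.PredFree (by
    rintro _ _ ⟨F, t, rfl, rfl⟩
    simp [Formula.inst, Formula.predFree_subst])

/-- The sentence is in `𝓗𝓜`, where different set constants may occur in place of `X`. -/
def IsHM : Sentence → Prop :=
  Quot.lift Formula.IsHM (by
    rintro _ _ ⟨F, t, rfl, rfl⟩
    simp [Formula.inst, Formula.isHM_subst])

/-- Truth in the least model. -/
def Holds : Sentence → Prop :=
  Quot.lift (fun A => A.Sat leastModel Fin.elim0) (by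
    rintro _ _ ⟨F, t, rfl, rfl⟩
    simp [Formula.sat_inst, Term.val, Term.eval_numeral])

/-- Truth with an ordinal bound. -/
def Verified (N : ℕ∞) (β : Ordinal.{0}) : Sentence → Prop :=
  Quot.lift (fun A => A.Verified (stage N) β Fin.elim0) (by
    rintro _ _ ⟨F, t, rfl, rfl⟩
    simp [Formula.verified_inst, Term.val, Term.eval_numeral])

theorem IsHarrop.predFree {S : Sentence} (h : S.IsHarrop) : S.PredFree := by
  obtain ⟨A, hA, rfl⟩ := h
  exact Formula.IsHarrop.predFree hA

/-- Passage to a wider class that is tested on each subformula separately, without keeping track of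
a common set constant. -/
theorem IsHMI.isHM {S : Sentence} (h : S.IsHMI) : S.IsHM := by
  obtain ⟨R, Φ, hR, rfl⟩ := h
  exact (Formula.isHM_mapPred _ _).2 hR

theorem Verified.mono {N : ℕ∞} {β γ : Ordinal.{0}} {S : Sentence} (h : S.Verified N β)
    (hβ : β ≤ γ) : S.Verified N γ := by
  induction S using Quot.ind with
  | mk A => exact Formula.Verified.mono (A := A) h hβ

theorem Verified.holds {N : ℕ∞} {β : Ordinal.{0}} {S : Sentence} (h : S.Verified N β) :
    S.Holds := by
  induction S using Quot.ind with
  | mk A => exact Formula.Verified.sat (A := A) β h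

/-- The sentences admitted as antecedents in the cut elimination: true arithmetical sentences and
`𝓗𝓜`-sentences verified with bound `β`. -/
def Admissible (N : ℕ∞) (β : Ordinal.{0}) (S : Sentence) : Prop :=
  S.PredFree ∧ S.Holds ∨ S.IsHM ∧ S.Verified N β

theorem Admissible.holds {N : ℕ∞} {β : Ordinal.{0}} {S : Sentence} (h : S.Admissible N β) :
    S.Holds :=
  h.elim And.right fun h => h.2.holds

theorem Admissible.mono {N : ℕ∞} {β γ : Ordinal.{0}} {S : Sentence} (h : S.Admissible N β)
    (hβ : β ≤ γ) : S.Admissible N γ :=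
  h.imp_right fun h => ⟨h.1, h.2.mono hβ⟩

end Sentence

/-! ### Cut free derivability -/

/-- All sentences of the sequent have logical complexity less than `N`. -/
def Sequent.ComplexityLT (N : ℕ∞) (T : Sequent) : Prop :=
  (T.suc.complexity : ℕ∞) < N ∧ ∀ A ∈ T.ant, (A.complexity : ℕ∞) < N

/-- Derivability without cuts, with depth at most `β`. -/
def CutFree (N : ℕ∞) (β : Ordinal.{0}) (S : Sequent) : Prop :=
  ∃ D : Derivation S, D.depth ≤ β ∧ D.cutFormulas = ∅ ∧ D.ComplexityLT N

theorem CutFree.mono {N : ℕ∞} {β γ : Ordinal.{0}} {S : Sequent} (h : CutFree N β S)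
    (hβ : β ≤ γ) : CutFree N γ S :=
  h.imp fun _ h => ⟨h.1.trans hβ, h.2⟩

theorem CutFree.derivable {N : ℕ∞} {β : Ordinal.{0}} {S : Sequent} (h : CutFree N β S) :
    Derivable N β 1 S := by
  obtain ⟨D, hd, hc, hN⟩ := h
  exact ⟨D, hd, by simp [Derivation.rank, hc], hN⟩

theorem CutFree.of_inference {N : ℕ∞} {β : Ordinal.{0}} {ι : Type} {prem : ι → Sequent}
    {S : Sequent} (h : Inference prem S) (hS : S.ComplexityLT N)
    (hp : ∀ i, ∃ γ < β, CutFree N γ (prem i)) : CutFree N β S := by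
  choose γ hγ D hd hc hN using hp
  refine ⟨.rule h D, ?_, ?_, ?_⟩
  · rw [Derivation.depth]
    exact Ordinal.iSup_le fun i => Order.add_one_le_of_lt ((hd i).trans_lt (hγ i))
  · simp [Derivation.cutFormulas, hc]
  · intro T hT
    rw [Derivation.sequents, Set.mem_insert_iff, Set.mem_iUnion] at hT
    obtain rfl | ⟨i, hi⟩ := hT
    · exact hS
    · exact hN i T hi

theorem CutFree.of_inference_zero {N : ℕ∞} {β : Ordinal.{0}} {S : Sequent}
    (h : Inference ![] S) (hS : S.ComplexityLT N) : CutFree N β S :=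
  .of_inference h hS fun i => i.elim0

theorem CutFree.of_inference_one {N : ℕ∞} {β γ : Ordinal.{0}} {S T : Sequent}
    (h : Inference ![T] S) (hS : S.ComplexityLT N) (hγ : γ < β) (hT : CutFree N γ T) :
    CutFree N β S :=
  .of_inference h hS fun i => ⟨γ, hγ, by rwa [Subsingleton.elim i 0]⟩

theorem CutFree.of_inference_two {N : ℕ∞} {β γ δ : Ordinal.{0}} {S T U : Sequent}
    (h : Inference ![T, U] S) (hS : S.ComplexityLT N) (hγ : γ < β) (hT : CutFree N γ T)
    (hδ : δ < β) (hU : CutFree N δ U) : CutFree N β S :=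
  .of_inference h hS (Fin.forall_fin_two.2 ⟨⟨γ, hγ, hT⟩, δ, hδ, hU⟩)

theorem Sequent.ComplexityLT.ant_insert {N : ℕ∞} {Γ : Finset Sentence} {A C : Sentence}
    (h : (Γ ⟹ C).ComplexityLT N) (hA : (A.complexity : ℕ∞) < N) :
    (insert A Γ ⟹ C).ComplexityLT N :=
  ⟨h.1, fun B hB => (Finset.mem_insert.1 hB).elim (fun e => e ▸ hA) (h.2 B)⟩

theorem Sequent.ComplexityLT.suc_of_le {N : ℕ∞} {Γ : Finset Sentence} {C C' : Sentence}
    (h : (Γ ⟹ C).ComplexityLT N) (hC : C'.complexity ≤ C.complexity) :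
    (Γ ⟹ C').ComplexityLT N :=
  ⟨(Nat.cast_le.2 hC).trans_lt h.1, h.2⟩

theorem complexity_mk (A : ClosedFormula) : (Sentence.mk A).complexity = A.complexity := rfl

theorem complexity_inst {P : Type} (B : Formula P 1) (t : Term 0) :
    (B.inst t).complexity = B.complexity :=
  Formula.complexity_subst _ _

/-- With the `ω`-rule, arithmetical sentences are decided in finitely many steps. -/
theorem CutFree.decide_arithmetical {N : ℕ∞} (m : ℕ) : ∀ A : ClosedFormula, A.complexity ≤ m →
    A.PredFree → (A.complexity : ℕ∞) < N →
    (A.Sat leastModel Fin.elim0 → ∀ (Γ : Finset Sentence), (Γ ⟹ .mk A).ComplexityLT N →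
      CutFree N m (Γ ⟹ .mk A)) ∧
    (¬ A.Sat leastModel Fin.elim0 → ∀ (Γ : Finset Sentence) (C : Sentence),
      (Γ ⟹ C).ComplexityLT N → CutFree N m (insert (.mk A) Γ ⟹ C)) := by
  -- The induction is on a bound for the complexity, because the instances `B(n)` are not
  -- subformulas of a quantified formula but have smaller complexity.
  induction m with
  | zero =>
    intro A hm hA hN
    cases A with
    | eq s t =>
      exact ⟨fun h Γ hΓ => .of_inference_zero (.initTop Γ s t h) hΓ,
        fun h Γ C hΓ => .of_inference_zero (.initBot Γ s t h C) (hΓ.ant_insert hN)⟩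
    | pred p t => exact hA.elim
    | or A B => simp [Formula.complexity] at hm
    | and A B => simp [Formula.complexity] at hm
    | imp A B => simp [Formula.complexity] at hm
    | ex A => simp [Formula.complexity] at hm
    | all A => simp [Formula.complexity] at hm
  | succ m ih =>
    intro A hm hA hN
    have hlt : (m : Ordinal.{0}) < (m + 1 : ℕ) := Nat.cast_lt.2 m.lt_succ_self
    have lt_of_le {a b : ℕ} (h : a ≤ b) (hb : (b : ℕ∞) < N) : (a : ℕ∞) < N :=
      (Nat.cast_le.2 h).trans_lt hb
    cases A with
    | eq s t =>
      exact ⟨fun h Γ hΓ => .of_inference_zero (.initTop Γ s t h) hΓ,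
        fun h Γ C hΓ => .of_inference_zero (.initBot Γ s t h C) (hΓ.ant_insert hN)⟩
    | pred p t => exact hA.elim
    | or A B =>
      simp only [Formula.complexity] at hm
      have cA : A.complexity ≤ (A.or B).complexity := by simp only [Formula.complexity]; lia
      have cB : B.complexity ≤ (A.or B).complexity := by simp only [Formula.complexity]; lia
      have iA := ih A (by lia) hA.1 (lt_of_le cA hN)
      have iB := ih B (by lia) hA.2 (lt_of_le cB hN)
      refine ⟨fun h Γ hΓ => ?_, fun h Γ C hΓ => ?_⟩
      · exact h.elim
          (fun h => .of_inference_one (.rightOr₀ Γ A B) hΓ hlt (iA.1 h Γ (hΓ.suc_of_le cA)))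
          (fun h => .of_inference_one (.rightOr₁ Γ A B) hΓ hlt (iB.1 h Γ (hΓ.suc_of_le cB)))
      · exact .of_inference_two (.leftOr Γ A B C) (hΓ.ant_insert hN)
          hlt (iA.2 (fun h' => h (.inl h')) Γ C hΓ) hlt (iB.2 (fun h' => h (.inr h')) Γ C hΓ)
    | and A B =>
      simp only [Formula.complexity] at hm
      have cA : A.complexity ≤ (A.and B).complexity := by simp only [Formula.complexity]; lia
      have cB : B.complexity ≤ (A.and B).complexity := by simp only [Formula.complexity]; lia
      have iA := ih A (by lia) hA.1 (lt_of_le cA hN)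
      have iB := ih B (by lia) hA.2 (lt_of_le cB hN)
      refine ⟨fun h Γ hΓ => ?_, fun h Γ C hΓ => ?_⟩
      · exact .of_inference_two (.rightAnd Γ A B) hΓ hlt (iA.1 h.1 Γ (hΓ.suc_of_le cA))
          hlt (iB.1 h.2 Γ (hΓ.suc_of_le cB))
      · have hΓ' := hΓ.ant_insert (A := .mk (A.and B)) hN
        by_cases h' : A.Sat leastModel Fin.elim0
        · exact .of_inference_one (.leftAnd₁ Γ A B C) hΓ' hlt
            (iB.2 (fun h'' => h ⟨h', h''⟩) _ C hΓ')
        · exact .of_inference_one (.leftAnd₀ Γ A B C) hΓ' hlt (iA.2 h' _ C hΓ')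
    | imp A B =>
      simp only [Formula.complexity] at hm
      have cA : A.complexity ≤ (A.imp B).complexity := by simp only [Formula.complexity]; lia
      have cB : B.complexity ≤ (A.imp B).complexity := by simp only [Formula.complexity]; lia
      have iA := ih A (by lia) hA.1 (lt_of_le cA hN)
      have iB := ih B (by lia) hA.2 (lt_of_le cB hN)
      refine ⟨fun h Γ hΓ => ?_, fun h Γ C hΓ => ?_⟩
      · have hB := hΓ.suc_of_le (C' := .mk B) cB
        refine .of_inference_one (.rightImp Γ A B) hΓ hlt ?_
        by_cases h' : A.Sat leastModel Fin.elim0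
        · exact iB.1 (h h') _ (hB.ant_insert (lt_of_le cA hN))
        · exact iA.2 h' Γ _ hB
      · obtain ⟨hA', hB'⟩ := Classical.not_imp.1 h
        have hΓ' := hΓ.ant_insert (A := .mk (A.imp B)) hN
        exact .of_inference_two (.leftImp Γ A B C) hΓ' hlt
          (iA.1 hA' _ ⟨lt_of_le cA hN, hΓ'.2⟩) hlt (iB.2 hB' Γ C hΓ)
    | ex B =>
      simp only [Formula.complexity] at hm
      have cB (n : ℕ) : (B.inst (Term.numeral n)).complexity ≤ B.ex.complexity := by
        simp only [complexity_inst, Formula.complexity]; lia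
      have iB (n : ℕ) := ih (B.inst (Term.numeral n)) (by rw [complexity_inst]; lia)
        ((Formula.predFree_subst _ _).2 hA) (lt_of_le (cB n) hN)
      refine ⟨fun ⟨n, h⟩ Γ hΓ => ?_, fun h Γ C hΓ => ?_⟩
      · exact .of_inference_one (.rightEx Γ B n) hΓ hlt
          ((iB n).1 ((Formula.sat_inst_numeral _ _ _ _).2 h) Γ (hΓ.suc_of_le (cB n)))
      · exact .of_inference (.leftEx Γ B C) (hΓ.ant_insert hN) fun n => ⟨m, hlt,
          (iB n).2 (fun h' => h ⟨n, (Formula.sat_inst_numeral _ _ _ _).1 h'⟩) Γ C hΓ⟩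
    | all B =>
      simp only [Formula.complexity] at hm
      have cB (n : ℕ) : (B.inst (Term.numeral n)).complexity ≤ B.all.complexity := by
        simp only [complexity_inst, Formula.complexity]; lia
      have iB (n : ℕ) := ih (B.inst (Term.numeral n)) (by rw [complexity_inst]; lia)
        ((Formula.predFree_subst _ _).2 hA) (lt_of_le (cB n) hN)
      refine ⟨fun h Γ hΓ => ?_, fun h Γ C hΓ => ?_⟩
      · exact .of_inference (.rightAll Γ B) hΓ fun n => ⟨m, hlt,
          (iB n).1 ((Formula.sat_inst_numeral _ _ _ _).2 (h n)) Γ (hΓ.suc_of_le (cB n))⟩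
      · obtain ⟨n, h⟩ := not_forall.1 h
        have hΓ' := hΓ.ant_insert (A := .mk B.all) hN
        exact .of_inference_one (.leftAll Γ B n C) hΓ' hlt
          ((iB n).2 (fun h' => h ((Formula.sat_inst_numeral _ _ _ _).1 h')) _ C hΓ')

theorem CutFree.of_not_sat {N : ℕ∞} {A : ClosedFormula} (hA : A.PredFree)
    (h : ¬ A.Sat leastModel Fin.elim0) (hN : (A.complexity : ℕ∞) < N) {Γ : Finset Sentence}
    {C : Sentence} (hΓ : (Γ ⟹ C).ComplexityLT N) :
    CutFree N A.complexity (insert (.mk A) Γ ⟹ C) :=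
  (decide_arithmetical A.complexity A le_rfl hA hN).2 h Γ C hΓ

/-- Bounded truth yields cut free derivations of bounded depth. -/
theorem CutFree.of_verified {N : ℕ∞} (β : Ordinal.{0}) : ∀ (A : ClosedFormula), A.IsHM →
    A.Verified (stage N) β Fin.elim0 → ∀ Γ : Finset Sentence, (Γ ⟹ .mk A).ComplexityLT N →
    CutFree N β (Γ ⟹ .mk A) := by
  induction β using WellFoundedLT.induction with
  | ind β ih =>
    intro A hA h Γ hΓ
    cases A with
    | eq s t => exact .of_inference_zero (.initTop Γ s t h) hΓ
    | pred Φ t =>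
      obtain ⟨hN, γ, hγ, h⟩ := (stage_iff_unfold _ _ _ _ _).1 h
      refine .of_inference_one (.rightI Γ Φ t) hΓ hγ (ih γ hγ _ (Φ.isHM_unfold t) h Γ ⟨?_, hΓ.2⟩)
      -- Unfolding can raise the complexity beyond that of the atom; the bound `N` built into
      -- `stage` keeps the premiss admissible.
      rwa [complexity_mk, Φ.complexity_unfold]
    | or A B =>
      obtain ⟨γ, hγ, h | h⟩ := h
      · exact .of_inference_one (.rightOr₀ Γ A B) hΓ hγ (ih γ hγ A hA.1 h Γ
          (hΓ.suc_of_le (by simp only [complexity_mk, Formula.complexity]; lia)))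
      · exact .of_inference_one (.rightOr₁ Γ A B) hΓ hγ (ih γ hγ B hA.2 h Γ
          (hΓ.suc_of_le (by simp only [complexity_mk, Formula.complexity]; lia)))
    | and A B =>
      obtain ⟨⟨γ, hγ, h⟩, δ, hδ, h'⟩ := h
      exact .of_inference_two (.rightAnd Γ A B) hΓ
        hγ (ih γ hγ A hA.1 h Γ
          (hΓ.suc_of_le (by simp only [complexity_mk, Formula.complexity]; lia)))
        hδ (ih δ hδ B hA.2 h' Γ
          (hΓ.suc_of_le (by simp only [complexity_mk, Formula.complexity]; lia)))
    | imp A B =>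
      have hN : (A.complexity : ℕ∞) < N := (hΓ.suc_of_le (C' := .mk A)
        (by simp only [complexity_mk, Formula.complexity]; lia)).1
      have hB : (Γ ⟹ .mk B).ComplexityLT N :=
        hΓ.suc_of_le (by simp only [complexity_mk, Formula.complexity]; lia)
      by_cases h' : A.Sat leastModel Fin.elim0
      · obtain ⟨γ, hγ, h⟩ := h.2 h'
        exact .of_inference_one (.rightImp Γ A B) hΓ hγ
          (ih γ hγ B hA.2 h _ (hB.ant_insert hN))
      -- A false premiss is refuted in finite depth; the clause `ω ≤ β` in the definition leaves
      -- room for this.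
      · exact .of_inference_one (.rightImp Γ A B) hΓ ((natCast_lt_omega0 _).trans_le h.1)
          (.of_not_sat hA.1.predFree h' hN hB)
    | ex B =>
      obtain ⟨γ, hγ, n, h⟩ := h
      exact .of_inference_one (.rightEx Γ B n) hΓ hγ (ih γ hγ (B.inst (Term.numeral n))
        ((Formula.isHM_subst B _).2 hA)
        ((Formula.verified_inst_numeral _ _ _ _ _).2 h) Γ
        (hΓ.suc_of_le (by simp only [complexity_mk, complexity_inst, Formula.complexity]; lia)))
    | all B =>
      refine .of_inference (.rightAll Γ B) hΓ fun n => ?_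
      obtain ⟨γ, hγ, h⟩ := h n
      exact ⟨γ, hγ, ih γ hγ (B.inst (Term.numeral n)) ((Formula.isHM_subst B _).2 hA)
        ((Formula.verified_inst_numeral _ _ _ _ _).2 h) Γ
        (hΓ.suc_of_le (by simp only [complexity_mk, complexity_inst, Formula.complexity]; lia))⟩

theorem Sentence.Verified.cutFree {N : ℕ∞} {β : Ordinal.{0}} {Γ : Finset Sentence} {C : Sentence}
    (h : C.Verified N β) (hC : C.IsHM) (hΓ : (Γ ⟹ C).ComplexityLT N) : CutFree N β (Γ ⟹ C) := by
  induction C using Quot.ind with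
  | mk A => exact CutFree.of_verified β A hC h Γ hΓ

theorem CutFree.of_not_holds {N : ℕ∞} {A C : Sentence} {Γ : Finset Sentence} (hA : A.PredFree)
    (h : ¬ A.Holds) (hΓ : (Γ ⟹ C).ComplexityLT N) (hmem : A ∈ Γ) : CutFree N ω (Γ ⟹ C) := by
  induction A using Quot.ind with
  | mk A =>
    have := CutFree.of_not_sat (A := A) hA h (hΓ.2 _ hmem) hΓ
    -- Antecedents are sets, so inserting the false sentence a second time changes nothing.
    rw [Finset.insert_eq_of_mem (by exact hmem)] at this
    exact this.mono (natCast_lt_omega0 _).le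

/-! ### Soundness -/

theorem forall_mem_insert_of {p : Sentence → Prop} {Γ : Finset Sentence} {A B : Sentence}
    (h : ∀ D ∈ insert A Γ, p D) (hB : p B) : ∀ D ∈ insert B Γ, p D :=
  Finset.forall_mem_insert _ _ _ |>.2 ⟨hB, fun D hD => h D (Finset.mem_insert_of_mem hD)⟩

theorem forall_mem_insert_insert_of {p : Sentence → Prop} {Γ : Finset Sentence} {A B : Sentence}
    (h : ∀ D ∈ insert A Γ, p D) (hB : p B) : ∀ D ∈ insert B (insert A Γ), p D :=
  Finset.forall_mem_insert _ _ _ |>.2 ⟨hB, h⟩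

/-- The calculus is sound for the least model. -/
theorem Derivation.sound {S : Sequent} (D : Derivation S) :
    (∀ A ∈ S.ant, A.Holds) → S.suc.Holds := by
  induction D with
  | cut d e ihd ihe =>
    intro h
    exact ihe (Finset.forall_mem_insert _ _ _ |>.2
      ⟨ihd fun B hB => h B (Finset.mem_union_left _ hB),
        fun B hB => h B (Finset.mem_union_right _ hB)⟩)
  | rule hI ds ih =>
    intro h
    cases hI with
    | initI Γ Φ t => exact h _ (Finset.mem_insert_self _ _)
    | initBot Γ s t hne C => exact absurd (h _ (Finset.mem_insert_self _ _)) hne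
    | initTop Γ s t heq => exact heq
    | leftI Γ Φ t C =>
      exact ih 0 (forall_mem_insert_of h
        ((leastModel_iff_unfold Φ t _).1 (h _ (Finset.mem_insert_self _ _))))
    | rightI Γ Φ t => exact (leastModel_iff_unfold Φ t _).2 (ih 0 h)
    | leftOr Γ A B C =>
      rcases h _ (Finset.mem_insert_self _ _) with hA | hB
      · exact ih 0 (forall_mem_insert_of h hA)
      · exact ih 1 (forall_mem_insert_of h hB)
    | rightOr₀ Γ A B => exact Or.inl (ih 0 h)
    | rightOr₁ Γ A B => exact Or.inr (ih 0 h)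
    | leftAnd₀ Γ A B C =>
      have hAB : A.Sat leastModel _ ∧ B.Sat leastModel _ := h _ (Finset.mem_insert_self _ _)
      exact ih 0 (forall_mem_insert_insert_of h hAB.1)
    | leftAnd₁ Γ A B C =>
      have hAB : A.Sat leastModel _ ∧ B.Sat leastModel _ := h _ (Finset.mem_insert_self _ _)
      exact ih 0 (forall_mem_insert_insert_of h hAB.2)
    | rightAnd Γ A B => exact ⟨ih 0 h, ih 1 h⟩
    | leftImp Γ A B C =>
      have hAB : A.Sat leastModel _ → B.Sat leastModel _ := h _ (Finset.mem_insert_self _ _)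
      exact ih 1 (forall_mem_insert_of h (hAB (ih 0 h)))
    | rightImp Γ A B =>
      exact fun hA => ih 0 (Finset.forall_mem_insert _ _ _ |>.2 ⟨hA, h⟩)
    | leftEx Γ B C =>
      obtain ⟨n, hB⟩ := h _ (Finset.mem_insert_self _ _)
      exact ih n (forall_mem_insert_of h ((Formula.sat_inst_numeral _ _ _ _).2 hB))
    | rightEx Γ B n => exact ⟨n, (Formula.sat_inst_numeral _ _ _ _).1 (ih 0 h)⟩
    | leftAll Γ B n C =>
      have hB : ∀ n : ℕ, B.Sat leastModel _ := h _ (Finset.mem_insert_self _ _)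
      exact ih 0 (forall_mem_insert_insert_of h ((Formula.sat_inst_numeral _ _ _ _).2 (hB n)))
    | rightAll Γ B => exact fun n => (Formula.sat_inst_numeral _ _ _ _).1 (ih n h)
    | rep Γ C => exact ih 0 h

/-! ### Elimination of cuts -/

/-- Powers of `ω` are additively principal. This is what a cut costs: two bounds added up fit into
the next power, the one for the depth of the conclusion. -/
theorem omega0_opow_add_omega0_opow_le (a b : Ordinal.{0}) :
    ω ^ a + ω ^ b ≤ ω ^ (max a b + 1) := by
  have h (c : Ordinal.{0}) (hc : c ≤ max a b) : ω ^ c < ω ^ (max a b + 1) :=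
    (opow_lt_opow_iff_right one_lt_omega0).2 (hc.trans_lt (lt_add_one _))
  exact (isPrincipal_add_omega0_opow _ (h a (le_max_left _ _)) (h b (le_max_right _ _))).le

theorem Derivation.mem_sequents {S : Sequent} (D : Derivation S) : S ∈ D.sequents := by
  cases D <;> exact Set.mem_insert _ _

theorem Derivation.depth_lt_depth_rule {ι : Type} {prem : ι → Sequent} {S : Sequent}
    (h : Inference prem S) (ds : (i : ι) → Derivation (prem i)) (i : ι) :
    (ds i).depth < (Derivation.rule h ds).depth := by
  rw [Derivation.depth]
  exact Order.add_one_le_iff.1 (Ordinal.le_iSup (fun i => (ds i).depth + 1) i)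

/-- A derivation from admissible antecedents of an `𝓗𝓜`-sentence, with cuts on arithmetical and
`𝓗𝓜`-sentences, bounds the verification of that sentence. -/
theorem Derivation.verified {N : ℕ∞} {S : Sequent} (D : Derivation S) :
    (∀ A ∈ D.cutFormulas, A.PredFree ∨ A.IsHM) → D.ComplexityLT N → ∀ β : Ordinal.{0},
    (∀ A ∈ S.ant, A.Admissible N β) → S.suc.IsHM → S.suc.Verified N (β + ω ^ D.depth) := by
  induction D with
  | @cut Γ Δ A C d e ihd ihe =>
    intro hc hN β h hC
    have hΓ : ∀ B ∈ Γ, B.Admissible N β := fun B hB => h B (Finset.mem_union_left _ hB)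
    have hΔ : ∀ B ∈ Δ, B.Admissible N β := fun B hB => h B (Finset.mem_union_right _ hB)
    have hcd : ∀ B ∈ d.cutFormulas, B.PredFree ∨ B.IsHM := fun B hB =>
      hc B (Set.mem_insert_of_mem _ (Or.inl hB))
    have hce : ∀ B ∈ e.cutFormulas, B.PredFree ∨ B.IsHM := fun B hB =>
      hc B (Set.mem_insert_of_mem _ (Or.inr hB))
    have hNd : d.ComplexityLT N := fun T hT => hN T (Set.mem_insert_of_mem _ (Or.inl hT))
    have hNe : e.ComplexityLT N := fun T hT => hN T (Set.mem_insert_of_mem _ (Or.inr hT))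
    -- An arithmetical cut formula need only be true, which soundness gives; an HM cut formula
    -- receives its bound from the left premiss, and the right premiss starts from that larger
    -- bound.
    have hA : A.Admissible N (β + ω ^ d.depth) := (hc A (Set.mem_insert _ _)).imp
      (fun hA => ⟨hA, d.sound fun B hB => (hΓ B hB).holds⟩)
      (fun hA => ⟨hA, ihd hcd hNd β hΓ hA⟩)
    refine (ihe hce hNe (β + ω ^ d.depth) (Finset.forall_mem_insert _ _ _ |>.2
      ⟨hA, fun B hB => (hΔ B hB).mono le_self_add⟩) hC).mono ?_
    rw [Derivation.depth, add_assoc]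
    exact add_le_add_right (omega0_opow_add_omega0_opow_le _ _) _
  | @rule ι prem S hI ds ih =>
    intro hc hN β h hC
    have hlt (i : ι) : β + ω ^ (ds i).depth < β + ω ^ (Derivation.rule hI ds).depth :=
      add_lt_add_right ((opow_lt_opow_iff_right one_lt_omega0).2 (depth_lt_depth_rule hI ds i)) _
    -- A rule with a premiss has depth at least `1`, so its power of `ω` is at least `ω`.
    have hω (i : ι) : ω ≤ β + ω ^ (Derivation.rule hI ds).depth := by
      refine (left_le_opow ω ?_).trans le_add_self
      exact zero_le.trans_lt (depth_lt_depth_rule hI ds i)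
    replace ih (i : ι) (h : ∀ A ∈ (prem i).ant, A.Admissible N β) (hC : (prem i).suc.IsHM) :
        (prem i).suc.Verified N (β + ω ^ (ds i).depth) :=
      ih i (fun A hA => hc A (Set.mem_iUnion.2 ⟨i, hA⟩))
        (fun T hT => hN T (Set.mem_insert_of_mem _ (Set.mem_iUnion.2 ⟨i, hT⟩))) β h hC
    have hprem (i : ι) : (prem i).ComplexityLT N :=
      hN (prem i) (Set.mem_insert_of_mem _ (Set.mem_iUnion.2 ⟨i, (ds i).mem_sequents⟩))
    clear hc hN
    have hβ : β ≤ β + ω ^ (Derivation.rule hI ds).depth := le_self_add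
    generalize β + ω ^ (Derivation.rule hI ds).depth = δ at hlt hω hβ ⊢
    have hle (i : ι) := (hlt i).le
    cases hI with
    | initI Γ Φ t =>
      rcases h _ (Finset.mem_insert_self _ _) with ⟨hp, -⟩ | ⟨-, hv⟩
      · exact hp.elim
      · exact hv.mono hβ
    | initBot Γ s t hne C => exact absurd (h _ (Finset.mem_insert_self _ _)).holds hne
    | initTop Γ s t heq => exact heq
    | leftI Γ Φ t C =>
      rcases h _ (Finset.mem_insert_self _ _) with ⟨hp, -⟩ | ⟨-, hv⟩
      · exact hp.elim
      · obtain ⟨-, γ, hγ, hv⟩ := (stage_iff_unfold _ _ _ _ _).1 hv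
        have hv' : (Sentence.mk (Φ.unfold t)).Verified N γ := hv
        -- The unfolding is verified below `β`, so the antecedents stay within `β` and the left rule
        -- costs nothing.
        exact (ih 0 (forall_mem_insert_of h (.inr ⟨Φ.isHM_unfold t, hv'.mono hγ.le⟩)) hC).mono
          (hle 0)
    | rightI Γ Φ t =>
      refine (stage_iff_unfold _ _ _ _ _).2 ⟨?_, _, hlt 0, ih 0 h (Φ.isHM_unfold t)⟩
      have := (hprem 0).1
      rwa [← Φ.complexity_unfold t]
    | leftOr Γ A B C =>
      rcases h _ (Finset.mem_insert_self _ _) with ⟨hp, hv⟩ | ⟨hp, γ, hγ, hv⟩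
      · rcases hv with hv | hv
        · exact (ih 0 (forall_mem_insert_of h (.inl ⟨hp.1, hv⟩)) hC).mono (hle 0)
        · exact (ih 1 (forall_mem_insert_of h (.inl ⟨hp.2, hv⟩)) hC).mono (hle 1)
      · rcases hv with hv | hv
        · exact (ih 0 (forall_mem_insert_of h (.inr ⟨hp.1, hv.mono hγ.le⟩)) hC).mono (hle 0)
        · exact (ih 1 (forall_mem_insert_of h (.inr ⟨hp.2, hv.mono hγ.le⟩)) hC).mono (hle 1)
    | rightOr₀ Γ A B => exact ⟨_, hlt 0, .inl (ih 0 h hC.1)⟩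
    | rightOr₁ Γ A B => exact ⟨_, hlt 0, .inr (ih 0 h hC.2)⟩
    | leftAnd₀ Γ A B C =>
      rcases h _ (Finset.mem_insert_self _ _) with ⟨hp, hv⟩ | ⟨hp, ⟨γ, hγ, hv⟩, -⟩
      · exact (ih 0 (forall_mem_insert_insert_of h (.inl ⟨hp.1, hv.1⟩)) hC).mono (hle 0)
      · exact (ih 0 (forall_mem_insert_insert_of h (.inr ⟨hp.1, hv.mono hγ.le⟩)) hC).mono (hle 0)
    | leftAnd₁ Γ A B C =>
      rcases h _ (Finset.mem_insert_self _ _) with ⟨hp, hv⟩ | ⟨hp, -, γ, hγ, hv⟩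
      · exact (ih 0 (forall_mem_insert_insert_of h (.inl ⟨hp.2, hv.2⟩)) hC).mono (hle 0)
      · exact (ih 0 (forall_mem_insert_insert_of h (.inr ⟨hp.2, hv.mono hγ.le⟩)) hC).mono (hle 0)
    | rightAnd Γ A B => exact ⟨⟨_, hlt 0, ih 0 h hC.1⟩, _, hlt 1, ih 1 h hC.2⟩
    | leftImp Γ A B C =>
      -- `A` may lie outside HM, where the induction hypothesis is silent; its truth is all that the
      -- implication asks for.
      have hA : A.Sat leastModel Fin.elim0 := (ds 0).sound fun D hD => (h D hD).holds
      rcases h _ (Finset.mem_insert_self _ _) with ⟨hp, hv⟩ | ⟨hp, -, hv⟩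
      · exact (ih 1 (forall_mem_insert_of h (.inl ⟨hp.2, hv hA⟩)) hC).mono (hle 1)
      · obtain ⟨γ, hγ, hv⟩ := hv hA
        exact (ih 1 (forall_mem_insert_of h (.inr ⟨hp.2, hv.mono hγ.le⟩)) hC).mono (hle 1)
    | rightImp Γ A B =>
      -- The premiss is Harrop, so once true it is admissible with the same `β`.
      exact ⟨hω 0, fun hA => ⟨_, hlt 0, ih 0 (Finset.forall_mem_insert _ _ _ |>.2
        ⟨.inl ⟨hC.1.predFree, hA⟩, h⟩) hC.2⟩⟩
    | leftEx Γ B C =>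
      rcases h _ (Finset.mem_insert_self _ _) with ⟨hp, n, hv⟩ | ⟨hp, γ, hγ, n, hv⟩
      · exact (ih n (forall_mem_insert_of h (.inl ⟨(Formula.predFree_subst B _).2 hp,
          (Formula.sat_inst_numeral _ _ _ _).2 hv⟩)) hC).mono (hle n)
      · exact (ih n (forall_mem_insert_of h (.inr ⟨(Formula.isHM_subst B _).2 hp,
          (Formula.verified_inst_numeral _ _ _ _ _).2 (hv.mono hγ.le)⟩)) hC).mono (hle n)
    | rightEx Γ B n =>
      exact ⟨_, hlt 0, n, (Formula.verified_inst_numeral _ _ _ _ _).1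
        (ih 0 h ((Formula.isHM_subst B _).2 hC))⟩
    | leftAll Γ B n C =>
      rcases h _ (Finset.mem_insert_self _ _) with ⟨hp, hv⟩ | ⟨hp, hv⟩
      · exact (ih 0 (forall_mem_insert_insert_of h (.inl ⟨(Formula.predFree_subst B _).2 hp,
          (Formula.sat_inst_numeral _ _ _ _).2 (hv n)⟩)) hC).mono (hle 0)
      · obtain ⟨γ, hγ, hv⟩ := hv n
        exact (ih 0 (forall_mem_insert_insert_of h (.inr ⟨(Formula.isHM_subst B _).2 hp,
          (Formula.verified_inst_numeral _ _ _ _ _).2 (hv.mono hγ.le)⟩)) hC).mono (hle 0)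
    | rightAll Γ B =>
      exact fun n => ⟨_, hlt n, (Formula.verified_inst_numeral _ _ _ _ _).1
        (ih n h ((Formula.isHM_subst B _).2 hC))⟩
    | rep Γ C => exact (ih 0 h hC).mono (hle 0)

/-! ### Ranks and cut formulas -/

theorem Sentence.rk_le_two (S : Sentence) : S.rk ≤ 2 := by
  unfold Sentence.rk
  split_ifs <;> simp

theorem Sentence.predFree_or_isHM_of_rk {S : Sentence} (h : S.rk < 2) : S.PredFree ∨ S.IsHM := by
  unfold Sentence.rk at h
  split_ifs at h with h₁ h₂
  · exact .inl h₁.predFree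
  · exact .inr h₂.isHM
  · exact absurd h (lt_irrefl _)

theorem Derivation.rk_le_rank {S : Sequent} (D : Derivation S) {A : Sentence}
    (hA : A ∈ D.cutFormulas) : A.rk ≤ D.rank :=
  le_csSup ⟨2, by rintro _ ⟨B, -, rfl⟩; exact B.rk_le_two⟩ (Set.mem_image_of_mem _ hA)

theorem Derivation.cutFormulas_eq_empty {S : Sequent} (D : Derivation S) (h : D.depth = 0) :
    D.cutFormulas = ∅ := by
  cases D with
  | cut d e => simp [Derivation.depth] at h
  | rule hI ds =>
    refine Set.iUnion_eq_empty.2 fun i => ?_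
    exact absurd (depth_lt_depth_rule hI ds i) (h ▸ not_lt_zero)

end FixedPointHM

/-! ### The theorem -/

open FixedPointHM
theorem theorem2 (N : ℕ∞) (α : Ordinal.{0}) (Γ₀ : Finset Sentence) (C₀ : Sentence)
    (hΓ₀ : ∀ A ∈ Γ₀, A.IsHarrop) (hC₀ : C₀.IsHMI)
    (h : Derivable N α 2 (Γ₀ ⟹ C₀)) :
    Derivable N (Ordinal.omega0 ^ α + 1) 1 (Γ₀ ⟹ C₀) := by
  obtain ⟨D, hα, hr, hN⟩ := h
  have hS : (Γ₀ ⟹ C₀).ComplexityLT N := hN _ D.mem_sequents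
  have hle : Ordinal.omega0 ^ D.depth ≤ Ordinal.omega0 ^ α + 1 :=
    (Ordinal.opow_le_opow_right Ordinal.omega0_pos hα).trans le_self_add
  suffices h : CutFree N (Ordinal.omega0 ^ D.depth) (Γ₀ ⟹ C₀) from (h.mono hle).derivable
  by_cases hT : ∀ A ∈ Γ₀, A.Holds
  · have hv := D.verified (fun A hA => Sentence.predFree_or_isHM_of_rk
      ((D.rk_le_rank hA).trans_lt hr)) hN 0 (fun A hA => .inl ⟨(hΓ₀ A hA).predFree, hT A hA⟩)
      hC₀.isHM
    rw [zero_add] at hv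
    exact hv.cutFree hC₀.isHM hS
  · push Not at hT
    obtain ⟨A, hA, hF⟩ := hT
    -- For depth `0` the bound `ω^0 = 1` has no room for a refutation of finite but arbitrary depth;
    -- but then the given derivation is already cut-free.
    by_cases h0 : D.depth = 0
    · exact ⟨D, by simp [h0], D.cutFormulas_eq_empty h0, hN⟩
    · exact (CutFree.of_not_holds (hΓ₀ A hA).predFree hF hS hA).mono
        (Ordinal.left_le_opow _ (pos_iff_ne_zero.2 h0))
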